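/- Let $\mathcal X$ be a real separable Hilbert space and let $\mu=N(0,\mathcal K)$ be a centered Gaussian Borel probability measure on $\mathcal X$ with covariance operator $\mathcal K$. Let $\mathcal H(\mu)=\mathcal K^{1/2}\mathcal X$ be its Cameron--Martin space, with norm $\|u\|_{\mathcal H(\mu)}=\|\mathcal K^{-1/2}u\|_{\mathcal X}$ for $u\in\mathcal H(\mu)$ (where $\mathcal K^{-1/2}u$ is the preimage of $u$ under $\mathcal K^{1/2}$ of smallest norm) and $\|u\|_{\mathcal H(\mu)}=+\infty$ for $u\in\mathcal X\setminus\mathcal H(\mu)$. Let $\phi_1,\dots,\phi_N\in\mathcal X^\ast$ be bounded linear functionals, let $\boldsymbol\phi(u)=(\phi_1(u),\dots,\phi_N(u))\in\mathbb R^N$, and let $F:\mathbb R^N\to\mathbb R^M$ be locally Lipschitz: for every $r>0$ there is $L(r)>0$ such that $|F(z_1)-F(z_2)|\le L(r)|z_1-z_2|$ for all $z_1,z_2\in\mathbb{R}^N$ with $|z_1|,|z_2|<r$ (Euclidean norms). Put $G=F\circ\boldsymbol\phi$, and let $\mu_0^y=\mu(\mathrm du\mid G(u)=y)$ denote the conditional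 of $\mu$ given $G(u)=y$. For $y\in\mathbb R^M$, a point $u^\dagger\in\mathcal X$ is called a conditional mode of $\mu_0^y$ if $y\in\operatorname{supp}G_\sharp\mu$, $G(u^\dagger)=y$ and $$\lim_{r\downarrow0}\frac{\mu(B_r(u^\dagger))}{\sup_{v\in G^{-1}(y)}\mu(B_r(v))}=1,$$ where $B_r(v)$ is the open ball in $\mathcal X$ of radius $r$ centered at $v$. (This notion depends only on $\mu$, $G$ and $y$.) Let $y\in F(\boldsymbol\phi(\mathcal H(\mu)))$. Then a point $u\in\mathcal X$ is a conditional mode of $\mu_0^y$ if and only if it is a (global) minimizer of the problem $$\min_{v\in\mathcal X}\ \|v\|_{\mathcal H(\mu)}\quad\text{subject to}\quad F(\boldsymbol\phi(v))=y.$$ -/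

import Mathlib

open MeasureTheory ProbabilityTheory Filter Set
open scoped Topology ENNReal RealInnerProductSpace

noncomputable section

/-! ### The positive square root of a positive operator on a real Hilbert space -/

section PosSqrt

variable {X : Type*} [NormedAddCommGroup X] [InnerProductSpace ℝ X] [CompleteSpace X]

/-- The iteration `Y₀ = 0`, `Yₙ₊₁ = (B + Yₙ²) / 2`, whose limit `Y` satisfies `(1 - Y)² = 1 - B`. -/
def sqrtIter {A : Type*} [Ring A] [Algebra ℝ A] (B : A) : ℕ → A
  | 0 => 0
  | n + 1 => (2⁻¹ : ℝ) • (B + sqrtIter B n * sqrtIter B n)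

theorem sqrtIter_one_le (n : ℕ) :
    0 ≤ sqrtIter (1 : ℝ) n ∧ sqrtIter (1 : ℝ) n ≤ 1 := by
  induction n with
  | zero => simp [sqrtIter]
  | succ n ih =>
    obtain ⟨h0, h1⟩ := ih
    simp only [sqrtIter, smul_eq_mul]
    constructor <;> nlinarith

theorem norm_sqrtIter_le {B : X →L[ℝ] X} (hB : ‖B‖ ≤ 1) (n : ℕ) :
    ‖sqrtIter B n‖ ≤ sqrtIter (1 : ℝ) n := by
  induction n with
  | zero => simp [sqrtIter]
  | succ n ih =>
    have h := norm_mul_le (sqrtIter B n) (sqrtIter B n)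
    have h2 := norm_add_le B (sqrtIter B n * sqrtIter B n)
    simp only [sqrtIter, smul_eq_mul, norm_smul, norm_inv, Real.norm_ofNat]
    nlinarith [norm_nonneg (sqrtIter B n)]

theorem norm_sqrtIter_sub_le {B : X →L[ℝ] X} (hB : ‖B‖ ≤ 1) (n : ℕ) :
    ‖sqrtIter B (n + 1) - sqrtIter B n‖ ≤ sqrtIter (1 : ℝ) (n + 1) - sqrtIter (1 : ℝ) n := by
  induction n with
  | zero => simpa [sqrtIter, norm_smul] using hB
  | succ n ih =>
    set P := sqrtIter B (n + 1) with hP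
    set Q := sqrtIter B n with hQ
    have e : sqrtIter B (n + 1 + 1) - P = (2⁻¹ : ℝ) • (P * (P - Q) + (P - Q) * Q) := by
      have h1 : sqrtIter B (n + 1 + 1) = (2⁻¹ : ℝ) • (B + P * P) := rfl
      have h2 : P = (2⁻¹ : ℝ) • (B + Q * Q) := rfl
      rw [h1]
      nth_rw 3 [h2]
      rw [← smul_sub]
      congr 1
      noncomm_ring
    have e' : sqrtIter (1 : ℝ) (n + 1 + 1) =
        2⁻¹ * (1 + sqrtIter (1 : ℝ) (n + 1) * sqrtIter (1 : ℝ) (n + 1)) := rfl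
    have e'' : sqrtIter (1 : ℝ) (n + 1) =
        2⁻¹ * (1 + sqrtIter (1 : ℝ) n * sqrtIter (1 : ℝ) n) := rfl
    have hPn := norm_sqrtIter_le hB (n + 1)
    have hQn := norm_sqrtIter_le hB n
    rw [← hP] at hPn
    rw [← hQ] at hQn
    have b1 : ‖P * (P - Q)‖ ≤ sqrtIter (1 : ℝ) (n + 1) *
        (sqrtIter (1 : ℝ) (n + 1) - sqrtIter (1 : ℝ) n) :=
      (norm_mul_le _ _).trans (mul_le_mul hPn ih (norm_nonneg _) (sqrtIter_one_le _).1)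
    have b2 : ‖(P - Q) * Q‖ ≤ (sqrtIter (1 : ℝ) (n + 1) - sqrtIter (1 : ℝ) n) *
        sqrtIter (1 : ℝ) n :=
      (norm_mul_le _ _).trans (mul_le_mul ih hQn (norm_nonneg _) ((norm_nonneg _).trans ih))
    have b3 := norm_add_le (P * (P - Q)) ((P - Q) * Q)
    rw [e, norm_smul, e']
    simp only [norm_inv, Real.norm_ofNat]
    nlinarith

theorem isSelfAdjoint_sqrtIter {B : X →L[ℝ] X} (hB : IsSelfAdjoint B) (n : ℕ) :
    IsSelfAdjoint (sqrtIter B n) := by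
  induction n with
  | zero => exact IsSelfAdjoint.zero _
  | succ n ih =>
    have h : IsSelfAdjoint (sqrtIter B n * sqrtIter B n) := by
      rw [isSelfAdjoint_iff, star_mul, ih.star_eq]
    exact IsSelfAdjoint.smul (IsSelfAdjoint.all (2⁻¹ : ℝ)) (hB.add h)

theorem exists_posSqrt_of_norm_le {A : X →L[ℝ] X} (hA : A.IsPositive) (hA1 : ‖A‖ ≤ 1) :
    ∃ S : X →L[ℝ] X, S.IsPositive ∧ S ∘L S = A := by
  have hB : ‖1 - A‖ ≤ 1 := by
    refine ContinuousLinearMap.opNorm_le_bound _ zero_le_one fun x => ?_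
    have h1 : 0 ≤ ⟪A (x - A x), x - A x⟫ := hA.inner_nonneg_left _
    have h2 : ⟪A (A x), A x⟫ ≤ ‖A x‖ ^ 2 := by
      have h3 := real_inner_le_norm (A (A x)) (A x)
      have h4 : ‖A (A x)‖ ≤ ‖A x‖ := by
        simpa using A.le_of_opNorm_le hA1 (A x)
      nlinarith [norm_nonneg (A x)]
    have h5 : ⟪A (A x), x⟫ = ‖A x‖ ^ 2 := by
      rw [hA.inner_left_eq_inner_right, real_inner_self_eq_norm_sq]
    simp only [map_sub, inner_sub_left, inner_sub_right, h5, real_inner_self_eq_norm_sq] at h1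
    have h6 : ‖x - A x‖ ^ 2 ≤ ‖x‖ ^ 2 := by
      rw [norm_sub_sq_real, real_inner_comm]
      nlinarith [sq_nonneg ‖A x‖, real_inner_comm x (A x)]
    simpa using le_of_sq_le_sq h6 (norm_nonneg x)
  have hBsa : IsSelfAdjoint (1 - A) := (IsSelfAdjoint.one _).sub hA.isSelfAdjoint
  have hmono : Monotone (sqrtIter (1 : ℝ)) := monotone_nat_of_le_succ fun n =>
    sub_nonneg.1 ((norm_nonneg _).trans (norm_sqrtIter_sub_le hB n))
  have hsum : Summable fun n => sqrtIter (1 : ℝ) (n + 1) - sqrtIter (1 : ℝ) n := by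
    refine summable_of_sum_range_le (c := 1) (fun n => sub_nonneg.2 (hmono n.le_succ)) fun n => ?_
    rw [Finset.sum_range_sub]
    simpa [sqrtIter] using (sqrtIter_one_le n).2
  have hc : CauchySeq (sqrtIter (1 - A)) :=
    cauchySeq_of_dist_le_of_summable _
      (fun n => by rw [dist_comm, dist_eq_norm]; exact norm_sqrtIter_sub_le hB n) hsum
  obtain ⟨Y, hY⟩ := cauchySeq_tendsto_of_complete hc
  have hYn : ‖Y‖ ≤ 1 := le_of_tendsto hY.norm
    (Eventually.of_forall fun n => (norm_sqrtIter_le hB n).trans (sqrtIter_one_le n).2)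
  have hYsa : IsSelfAdjoint Y := by
    have h := (continuous_star.tendsto Y).comp hY
    refine tendsto_nhds_unique h (hY.congr fun n => ?_)
    exact (isSelfAdjoint_sqrtIter hBsa n).star_eq.symm
  have hfix : Y = (2⁻¹ : ℝ) • (1 - A + Y * Y) := by
    refine tendsto_nhds_unique ((tendsto_add_atTop_iff_nat 1).2 hY) ?_
    exact ((tendsto_const_nhds.add (hY.mul hY)).const_smul _)
  refine ⟨1 - Y, ?_, ?_⟩
  · rw [ContinuousLinearMap.isPositive_iff']
    refine ⟨(IsSelfAdjoint.one _).sub hYsa, fun x => ?_⟩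
    have h1 := real_inner_le_norm (Y x) x
    have h2 : ‖Y x‖ ≤ ‖x‖ := by simpa using Y.le_of_opNorm_le hYn x
    simp only [sub_apply, one_apply_eq_self, inner_sub_left,
      real_inner_self_eq_norm_sq]
    nlinarith [norm_nonneg x]
  · have h2 : (2 : ℝ) • Y = 1 - A + Y * Y := by
      nth_rw 1 [hfix]
      rw [smul_smul]
      norm_num
    change (1 - Y) * (1 - Y) = A
    have h3 : (1 - Y) * (1 - Y) = 1 - (2 : ℝ) • Y + Y * Y := by
      rw [two_smul]
      noncomm_ring
    rw [h3, h2]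
    noncomm_ring

/-- Every positive operator on a real Hilbert space has a positive square root. -/
theorem exists_posSqrt {K : X →L[ℝ] X} (hK : K.IsPositive) :
    ∃ S : X →L[ℝ] X, S.IsPositive ∧ S ∘L S = K := by
  set c : ℝ := ‖K‖ + 1 with hc
  have hc0 : 0 < c := by positivity
  obtain ⟨S, hS, hSS⟩ := exists_posSqrt_of_norm_le (A := c⁻¹ • K)
    (hK.smul_of_nonneg (inv_nonneg.2 hc0.le)) (by
      rw [norm_smul, Real.norm_of_nonneg (inv_nonneg.2 hc0.le), inv_mul_le_iff₀ hc0]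
      linarith)
  refine ⟨Real.sqrt c • S, hS.smul_of_nonneg (Real.sqrt_nonneg c), ?_⟩
  rw [ContinuousLinearMap.smul_comp, ContinuousLinearMap.comp_smul, hSS, smul_smul, smul_smul,
    Real.mul_self_sqrt hc0.le, mul_inv_cancel₀ hc0.ne', one_smul]

end PosSqrt

section Definitions

variable {X : Type*} [NormedAddCommGroup X] [InnerProductSpace ℝ X] [CompleteSpace X]
  [MeasurableSpace X] [BorelSpace X]

/-- The positive square root `𝒦^{1/2}` of the covariance operator `𝒦` of `μ`
(for the covariance operator of a centered measure,
`⟪𝒦 x, y⟫ = ∫ z, ⟪x, z⟫ * ⟪y, z⟫ ∂μ`). -/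
def covarianceSqrt (μ : Measure X) : X →L[ℝ] X :=
  (exists_posSqrt (K := covarianceOperator μ) isPositive_covarianceOperator).choose

theorem covarianceSqrt_isPositive (μ : Measure X) : (covarianceSqrt μ).IsPositive :=
  (exists_posSqrt (K := covarianceOperator μ) isPositive_covarianceOperator).choose_spec.1

theorem covarianceSqrt_comp_self (μ : Measure X) :
    covarianceSqrt μ ∘L covarianceSqrt μ = covarianceOperator μ :=
  (exists_posSqrt (K := covarianceOperator μ) isPositive_covarianceOperator).choose_spec.2

/-- The Cameron–Martin space `ℋ(μ) = 𝒦^{1/2} X` of a centered Gaussian measure `μ = N(0, 𝒦)`. -/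
def cameronMartinSpace (μ : Measure X) : Submodule ℝ X :=
  LinearMap.range (covarianceSqrt μ).toLinearMap

/-- The Cameron–Martin norm `‖u‖_{ℋ(μ)} = ‖𝒦^{-1/2} u‖`, extended by `∞` to `X ∖ ℋ(μ)`.
When `𝒦^{1/2}` is not injective, `𝒦^{-1/2} u` is the preimage of `u` of smallest norm. -/
def cameronMartinNorm (μ : Measure X) (u : X) : ℝ≥0∞ :=
  ⨅ (w : X) (_ : covarianceSqrt μ w = u), ‖w‖ₑ

/-- `u` is a conditional mode of `ν(du ∣ T(u) = y)`. As in the usual definition, the small balls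
are measured by `ν` itself and their centers are restricted to the fibre `T⁻¹(y)`. -/
def IsConditionalMode {Y : Type*} [TopologicalSpace Y] [MeasurableSpace Y]
    (ν : Measure X) (T : X → Y) (y : Y) (u : X) : Prop :=
  y ∈ (ν.map T).support ∧ u ∈ T ⁻¹' {y} ∧
    Tendsto (fun r : ℝ => ν (Metric.ball u r) / ⨆ v ∈ T ⁻¹' {y}, ν (Metric.ball v r))
      (𝓝[>] 0) (𝓝 1)

/-- The vector of observations `φ(u) = (φ₁(u), …, φ_N(u))`. -/
def observation {N : ℕ} (φ : Fin N → StrongDual ℝ X) (u : X) : EuclideanSpace ℝ (Fin N) :=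
  WithLp.toLp 2 fun i => φ i u

/-- Lipschitz on every ball around the origin. -/
def LipschitzOnBalls {E E' : Type*} [NormedAddCommGroup E] [NormedAddCommGroup E']
    (F : E → E') : Prop :=
  ∀ r > 0, ∃ L > 0, ∀ z₁ ∈ Metric.ball (0 : E) r, ∀ z₂ ∈ Metric.ball (0 : E) r,
    ‖F z₁ - F z₂‖ ≤ L * ‖z₁ - z₂‖

/-- `u` is a global minimizer of `‖·‖_{ℋ(μ)}` over all points of `X` with `T(u) = y`. -/
def IsConstrainedMinimizer {Y : Type*} (μ : Measure X) (T : X → Y) (y : Y) (u : X) : Prop :=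
  T u = y ∧ ∀ v : X, T v = y → cameronMartinNorm μ u ≤ cameronMartinNorm μ v

end Definitions

end

/-! Write `K = S²` with `S` the positive root. Everything rests on comparing `μ(B_r(v))` with
`μ(B_r(0))`. Lower bound: `μ(B_r(0)) ≤ exp(‖x‖²/2) μ(B_r(Sx))` for every `r`
(`measure_ball_zero_le_exp_mul`). For a shift by `Kw` this is Cameron–Martin plus the symmetry of
`μ`; density and projection extend it to all `x`. Upper bound: for every `w`, `μ(B_r(v)) ≤
exp(-(⟪w,v⟫ - ⟪Kw,w⟫/2 - r‖w‖)) μ(B_r(0))` (`measure_ball_le_exp_mul`), by Cameron–Martin and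
Anderson's inequality. The two match as `r → 0`, since the supremum over `w` of `⟪w,v⟫ - ‖Sw‖²/2` is
half the squared Cameron–Martin norm of `v` (`exists_apply_eq_norm_le_of_forall_inner_le`). A mode
is therefore a minimizer: compare it with each competitor in the fibre and let `r → 0`. The converse
needs an upper bound uniform over the unbounded fibre. As the constraint sees only `Φ v` in a
finite-dimensional space, it suffices to take `w` in the range of the adjoint of `Φ`; compactness
then leaves finitely many such `w` (`eventually_measure_ball_le`). -/

theorem inner_covarianceOperator_self_nonneg {E : Type*} [NormedAddCommGroup E] [InnerProductSpace ℝ E]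
    [CompleteSpace E] [MeasurableSpace E] [BorelSpace E] {μ : Measure E} (w : E) : 0 ≤ ⟪covarianceOperator μ w, w⟫ :=
  (ContinuousLinearMap.IsPositive.inner_nonneg_left
    (show (covarianceOperator μ).IsPositive from isPositive_covarianceOperator) w)

/-! ### Exponential moments and the Cameron–Martin formula. -/

section Gaussian

variable {E : Type*} [NormedAddCommGroup E] [InnerProductSpace ℝ E] [CompleteSpace E]
  [SecondCountableTopology E] [MeasurableSpace E] [BorelSpace E]
  {μ : Measure E} [IsGaussian μ]

theorem integral_inner_eq_zero (hμ : ∫ x, x ∂μ = 0) (w : E) : ∫ x, ⟪w, x⟫ ∂μ = 0 := by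
  have h := IsGaussian.integral_dual (μ := μ) (innerSL ℝ w)
  simpa [hμ] using h

theorem covariance_inner_inner (hμ : ∫ x, x ∂μ = 0) (a b : E) :
    cov[fun x => ⟪a, x⟫, fun x => ⟪b, x⟫; μ] = ⟪covarianceOperator μ a, b⟫ := by
  rw [covarianceOperator_inner IsGaussian.memLp_two_id, covariance]
  simp [integral_inner_eq_zero hμ]

theorem variance_inner (hμ : ∫ x, x ∂μ = 0) (w : E) :
    Var[fun x => ⟪w, x⟫; μ] = ⟪covarianceOperator μ w, w⟫ := by
  rw [← covariance_self (by fun_prop), covariance_inner_inner hμ]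

theorem map_inner_eq_gaussianReal (hμ : ∫ x, x ∂μ = 0) (w : E) :
    μ.map (fun x => ⟪w, x⟫) = gaussianReal 0 (⟪covarianceOperator μ w, w⟫).toNNReal := by
  have h := IsGaussian.map_eq_gaussianReal (μ := μ) (innerSL ℝ w)
  have h1 : (⇑(innerSL ℝ w) : E → ℝ) = fun x => ⟪w, x⟫ := by ext; simp
  rw [h1, integral_inner_eq_zero hμ, variance_inner hμ] at h
  exact h

theorem mgf_inner (hμ : ∫ x, x ∂μ = 0) (w : E) (t : ℝ) :
    mgf (fun x => ⟪w, x⟫) μ t = Real.exp (⟪covarianceOperator μ w, w⟫ * t ^ 2 / 2) := by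
  rw [mgf_gaussianReal (map_inner_eq_gaussianReal hμ w),
    Real.coe_toNNReal _ (inner_covarianceOperator_self_nonneg w)]
  simp

theorem integral_exp_inner (hμ : ∫ x, x ∂μ = 0) (w : E) :
    ∫ x, Real.exp ⟪w, x⟫ ∂μ = Real.exp (⟪covarianceOperator μ w, w⟫ / 2) := by
  simpa [mgf] using mgf_inner hμ w 1

theorem integrable_exp_inner (hμ : ∫ x, x ∂μ = 0) (w : E) :
    Integrable (fun x => Real.exp ⟪w, x⟫) μ := by
  by_contra h
  have := integral_exp_inner hμ w
  rw [integral_undef h] at this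
  exact (Real.exp_pos _).ne this

theorem map_neg_eq_self (hμ : ∫ x, x ∂μ = 0) : μ.map (fun x => -x) = μ := by
  have h0 : ∫ x, x ∂(μ.map fun x => -x) = 0 := by
    rw [integral_map (by fun_prop) (by fun_prop), integral_neg, hμ, neg_zero]
  refine Measure.ext_of_charFunDual (funext fun L => ?_)
  rw [IsGaussian.charFunDual_eq_of_integral_eq_zero (by simpa using h0),
    IsGaussian.charFunDual_eq_of_integral_eq_zero (by simpa using hμ),
    variance_map (by fun_prop) (by fun_prop)]
  have : (⇑L ∘ fun x : E => -x) = -⇑L := by ext; simp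
  rw [this, variance_neg]

/-- Two finite measures with the same everywhere finite moment generating function coincide. -/
theorem map_eq_of_mgf_eq {Ω Ω' : Type*} {mΩ : MeasurableSpace Ω} {mΩ' : MeasurableSpace Ω'}
    {P : Measure Ω} {P' : Measure Ω'} [IsProbabilityMeasure P] [IsProbabilityMeasure P']
    {Y : Ω → ℝ} {Y' : Ω' → ℝ} (hY : AEMeasurable Y P) (hY' : AEMeasurable Y' P')
    (hint : ∀ t, Integrable (fun ω => Real.exp (t * Y ω)) P) (h : mgf Y P = mgf Y' P') :
    P.map Y = P'.map Y' := by
  refine Measure.ext_of_complexMGF_eq hY hY' (funext fun z => ?_)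
  have hset : integrableExpSet Y P = univ := eq_univ_of_forall hint
  exact eqOn_complexMGF_of_mgf h (by simp [hset])

/-- Both laws are tested on one-dimensional marginals, where their moment generating functions agree
after expanding `⟪K(w + ta), w + ta⟫`. -/
theorem map_add_covarianceOperator_eq_tilted (hμ : ∫ x, x ∂μ = 0) (w : E) :
    μ.map (fun x => x + covarianceOperator μ w) = μ.tilted fun x => ⟪w, x⟫ := by
  have : IsProbabilityMeasure (μ.tilted fun x => ⟪w, x⟫) :=
    isProbabilityMeasure_tilted (integrable_exp_inner hμ w)
  refine Measure.ext_of_charFunDual (funext fun L => ?_)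
  set a := (InnerProductSpace.toDual ℝ E).symm L with ha
  have hL : (⇑L : E → ℝ) = fun x => ⟪a, x⟫ := by ext; simp [ha]
  have hK : ∀ x y : E, ⟪covarianceOperator μ x, y⟫ = ⟪x, covarianceOperator μ y⟫ :=
    fun x y => isPositive_covarianceOperator.isSymmetric x y
  rw [charFunDual_eq_charFun_map_one, charFunDual_eq_charFun_map_one]
  congr 1
  refine map_eq_of_mgf_eq (by fun_prop) (by fun_prop) (fun t => ?_) (funext fun t => ?_)
  · rw [integrable_map_measure (by fun_prop) (by fun_prop)]
    refine ((integrable_exp_inner hμ (t • a)).const_mul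
      (Real.exp (t * L (covarianceOperator μ w)))).congr (ae_of_all _ fun x => ?_)
    simp [hL, inner_add_right, mul_add, Real.exp_add, inner_smul_left, mul_comm]
  · rw [mgf, mgf, integral_map (by fun_prop) (by fun_prop), integral_exp_tilted,
      integral_exp_inner hμ]
    have e1 : ∀ x, Real.exp (t * L (x + covarianceOperator μ w)) =
        Real.exp (t * ⟪a, covarianceOperator μ w⟫) * Real.exp ⟪t • a, x⟫ := by
      intro x
      rw [← Real.exp_add]
      simp [hL, inner_add_right, inner_smul_left]
      ring
    have e2 : ∀ x, Real.exp (((fun x => ⟪w, x⟫) + fun x => t * L x) x) =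
        Real.exp ⟪w + t • a, x⟫ := by
      intro x
      simp [hL, inner_add_left, inner_smul_left]
    simp_rw [e1, e2]
    rw [integral_const_mul, integral_exp_inner hμ, integral_exp_inner hμ, ← Real.exp_add,
      ← Real.exp_sub]
    congr 1
    simp only [map_add, map_smul, inner_add_left, inner_add_right, inner_smul_left,
      inner_smul_right, RCLike.conj_to_real]
    rw [hK a w, hK w a, real_inner_comm (covarianceOperator μ a) w, hK a w]
    ring

/-- The Cameron–Martin formula for a shift in the range of the covariance operator. -/
theorem measure_preimage_add_covarianceOperator (hμ : ∫ x, x ∂μ = 0) (w : E) {s : Set E}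
    (hs : MeasurableSet s) :
    μ ((fun x => x + covarianceOperator μ w) ⁻¹' s) =
      ∫⁻ x in s, ENNReal.ofReal (Real.exp (⟪w, x⟫ - ⟪covarianceOperator μ w, w⟫ / 2)) ∂μ := by
  rw [← Measure.map_apply (by fun_prop) hs, map_add_covarianceOperator_eq_tilted hμ,
    tilted_apply' _ _ hs, integral_exp_inner hμ]
  simp_rw [Real.exp_sub]

end Gaussian

/-! ### Anderson's inequality for balls. -/

/-- The slack `r - s` later absorbs the passage to closed balls and small displacements of the
center. -/
theorem measure_ball_le_of_forall_lt {Y : Type*} [PseudoMetricSpace Y] [MeasurableSpace Y]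
    {ν : Measure Y} {v : Y} {r : ℝ} {C : ℝ≥0∞} (h : ∀ s < r, ν (Metric.ball v s) ≤ C) :
    ν (Metric.ball v r) ≤ C := by
  obtain ⟨s, hs, hsr, hlim⟩ := exists_seq_strictMono_tendsto r
  have hU : Metric.ball v r = ⋃ n, Metric.ball v (s n) := by
    refine Subset.antisymm (fun x hx => ?_) (iUnion_subset fun n => Metric.ball_subset_ball (hsr n).le)
    obtain ⟨n, hn⟩ := (hlim.eventually_const_lt (Metric.mem_ball.1 hx)).exists
    exact mem_iUnion.2 ⟨n, hn⟩
  have hmono : Monotone fun n => Metric.ball v (s n) := fun _ _ hmn =>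
    Metric.ball_subset_ball (hs.monotone hmn)
  rw [hU]
  exact le_of_tendsto' (tendsto_measure_iUnion_atTop hmono) fun n => h _ (hsr n)

/-- Among the intervals of a given length, the centered one has the largest measure under a
centered Gaussian. -/
theorem gaussianReal_ball_le (v : NNReal) (a s : ℝ) :
    gaussianReal 0 v (Metric.ball a s) ≤ gaussianReal 0 v (Metric.ball 0 s) := by
  rcases le_or_gt s 0 with hs | hs
  · simp [Metric.ball_eq_empty.2 hs]
  rcases eq_or_ne v 0 with rfl | hv
  · rw [gaussianReal_zero_var, Measure.dirac_apply' (0 : ℝ) Metric.isOpen_ball.measurableSet,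
      Measure.dirac_apply' (0 : ℝ) Metric.isOpen_ball.measurableSet]
    rw [indicator_of_mem (Metric.mem_ball_self hs)]
    exact indicator_le_self' (by simp) _
  set A := Metric.ball a s
  set B := Metric.ball (0 : ℝ) s
  have hA : MeasurableSet A := Metric.isOpen_ball.measurableSet
  have hB : MeasurableSet B := Metric.isOpen_ball.measurableSet
  have hpdf : ∀ x z : ℝ, |x| ≤ |z| → gaussianPDF 0 v z ≤ gaussianPDF 0 v x := by
    intro x z h
    refine ENNReal.ofReal_le_ofReal ?_
    have h2 := sq_le_sq.2 h
    simp only [gaussianPDFReal, sub_zero]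
    gcongr
  have hvol : volume (A \ B) = volume (B \ A) := by
    have h1 : volume A = volume B := by simp [A, B]
    have h2 := measure_inter_add_sdiff (μ := volume) A hB
    have h3 := measure_inter_add_sdiff (μ := volume) B hA
    rw [inter_comm B A, ← h1, ← h2] at h3
    have hfin : volume (A ∩ B) ≠ ∞ :=
      ((measure_mono inter_subset_left).trans_lt Metric.isBounded_ball.measure_lt_top).ne
    exact ((ENNReal.add_right_inj hfin).1 h3).symm
  -- The differences have equal length, and the density at `s` separates its values outside `B` from
  -- those inside.
  have hdiff : gaussianReal 0 v (A \ B) ≤ gaussianReal 0 v (B \ A) := by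
    rw [gaussianReal_apply 0 hv, gaussianReal_apply 0 hv]
    calc ∫⁻ x in A \ B, gaussianPDF 0 v x
        ≤ ∫⁻ _ in A \ B, gaussianPDF 0 v s := by
          refine setLIntegral_mono' (hA.diff hB) fun x hx => hpdf _ _ ?_
          have := hx.2
          simp only [B, Metric.mem_ball, dist_zero_right, Real.norm_eq_abs, not_lt] at this
          rwa [abs_of_pos hs]
      _ = ∫⁻ _ in B \ A, gaussianPDF 0 v s := by simp [hvol]
      _ ≤ ∫⁻ x in B \ A, gaussianPDF 0 v x := by
          refine setLIntegral_mono' (hB.diff hA) fun x hx => hpdf _ _ ?_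
          have := hx.1
          simp only [B, Metric.mem_ball, dist_zero_right, Real.norm_eq_abs] at this
          rw [abs_of_pos hs]
          exact this.le
  rw [← measure_inter_add_sdiff A hB, ← measure_inter_add_sdiff B hA, inter_comm B A]
  gcongr

section Anderson

variable {E : Type*} [NormedAddCommGroup E] [InnerProductSpace ℝ E] [CompleteSpace E]
  [SecondCountableTopology E] [MeasurableSpace E] [BorelSpace E]
  {μ : Measure E} [IsGaussian μ]

/-- The pair is jointly Gaussian, so vanishing covariance suffices; since `K e` is parallel to `e`,
it is orthogonal to the complement of `e`. -/
theorem indepFun_inner_sub_of_eigenvector (hμ : ∫ x, x ∂μ = 0) {e : E} (he : ‖e‖ = 1) {c : ℝ}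
    (hc : covarianceOperator μ e = c • e) :
    IndepFun (fun x => ⟪e, x⟫) (fun x => x - ⟪e, x⟫ • e) μ := by
  refine HasGaussianLaw.indepFun_of_covariance_inner ?_ fun t x => ?_
  · exact (IsGaussian.hasGaussianLaw_id (μ := μ)).map
      ((innerSL ℝ e).prod (.id ℝ E - (innerSL ℝ e).smulRight e))
  · have e1 : (fun z => ⟪t, ⟪e, z⟫⟫) = fun z => ⟪t • e, z⟫ := by
      ext z; simp [inner_smul_left, mul_comm]
    have e2 : (fun z => ⟪x, z - ⟪e, z⟫ • e⟫) = fun z => ⟪x - ⟪e, x⟫ • e, z⟫ := by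
      ext z
      simp only [inner_sub_right, inner_sub_left, inner_smul_left, inner_smul_right,
        RCLike.conj_to_real, real_inner_comm e x]
      ring
    rw [e1, e2, covariance_inner_inner hμ]
    simp [hc, inner_smul_left, inner_smul_right, inner_sub_right, he]
    ring

/-- Removing from the center of a ball its component along an eigenvector of the covariance
operator does not decrease the measure. -/
theorem measure_ball_le_of_eigenvector (hμ : ∫ x, x ∂μ = 0) {e : E} (he : ‖e‖ = 1) {c : ℝ}
    (hc : covarianceOperator μ e = c • e) (v : E) (r : ℝ) :
    μ (Metric.ball v r) ≤ μ (Metric.ball (v - ⟪e, v⟫ • e) r) := by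
  rcases le_or_gt r 0 with hr | hr
  · simp [Metric.ball_eq_empty.2 hr]
  set ν := μ.map fun x => ⟪e, x⟫
  set ρ := μ.map fun x => x - ⟪e, x⟫ • e
  have : IsProbabilityMeasure ν := Measure.isProbabilityMeasure_map (by fun_prop)
  have : IsProbabilityMeasure ρ := Measure.isProbabilityMeasure_map (by fun_prop)
  have hprod : μ.map (fun x => (⟪e, x⟫, x - ⟪e, x⟫ • e)) = ν.prod ρ :=
    (indepFun_iff_map_prod_eq_prod_map_map (by fun_prop) (by fun_prop)).1
      (indepFun_inner_sub_of_eigenvector hμ he hc)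
  set q := v - ⟪e, v⟫ • e with hq
  have hee : ⟪e, e⟫ = (1 : ℝ) := by rw [real_inner_self_eq_norm_sq, he]; norm_num
  -- Fubini along `e`: each slice of the ball is an interval centered at `a`. Where the radicand is
  -- negative, `Real.sqrt` gives radius `0` and the slice is correctly empty.
  have key : ∀ a : ℝ, μ (Metric.ball (q + a • e) r) =
      ∫⁻ p, ν (Metric.ball a (Real.sqrt (r ^ 2 - ‖p - q‖ ^ 2))) ∂ρ := by
    intro a
    set s : Set (ℝ × E) := {z | (z.1 - a) ^ 2 + ‖z.2 - q‖ ^ 2 < r ^ 2} with hs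
    have hsm : MeasurableSet s := (isOpen_lt (by fun_prop) (by fun_prop)).measurableSet
    have h1 : Metric.ball (q + a • e) r = (fun x => (⟪e, x⟫, x - ⟪e, x⟫ • e)) ⁻¹' s := by
      ext x
      have h2 : x - (q + a • e) = (⟪e, x⟫ - a) • e + (x - ⟪e, x⟫ • e - q) := by
        rw [sub_smul]; abel
      have h3 : ⟪(⟪e, x⟫ - a) • e, x - ⟪e, x⟫ • e - q⟫ = 0 := by
        simp only [hq, inner_smul_left, inner_sub_right, inner_smul_right, hee]
        ring
      have h4 : ‖x - (q + a • e)‖ ^ 2 = (⟪e, x⟫ - a) ^ 2 + ‖x - ⟪e, x⟫ • e - q‖ ^ 2 := by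
        rw [h2, norm_add_sq_real, h3, norm_smul, he]
        simp
      simp only [Metric.mem_ball, dist_eq_norm, hs, mem_preimage, mem_ofPred_eq, ← h4]
      rw [sq_lt_sq₀ (norm_nonneg _) hr.le]
    rw [h1, ← Measure.map_apply (by fun_prop) hsm, hprod, Measure.prod_apply_symm hsm]
    refine lintegral_congr fun p => ?_
    congr 1
    ext t
    simp only [hs, mem_preimage, mem_ofPred_eq, Metric.mem_ball, Real.dist_eq]
    rw [Real.lt_sqrt (abs_nonneg _), sq_abs, lt_sub_iff_add_lt]
  have hv : v = q + ⟪e, v⟫ • e := by rw [hq]; abel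
  have h0 := key 0
  rw [zero_smul, add_zero] at h0
  rw [h0]
  nth_rw 1 [hv]
  rw [key]
  refine lintegral_mono fun p => ?_
  simp only [ν, map_inner_eq_gaussianReal hμ e]
  exact gaussianReal_ball_le _ _ _

/-- The coordinates of the center in an eigenbasis of `K` are removed one at a time. -/
theorem measure_ball_le_of_finiteDimensional [FiniteDimensional ℝ E] (hμ : ∫ x, x ∂μ = 0)
    (v : E) (r : ℝ) : μ (Metric.ball v r) ≤ μ (Metric.ball 0 r) := by
  have hsym : (covarianceOperator μ).toLinearMap.IsSymmetric :=
    isPositive_covarianceOperator.isSymmetric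
  set b := hsym.eigenvectorBasis rfl
  have key : ∀ t : Finset (Fin (Module.finrank ℝ E)),
      μ (Metric.ball v r) ≤ μ (Metric.ball (v - ∑ i ∈ t, ⟪b i, v⟫ • b i) r) := by
    intro t
    induction t using Finset.induction_on with
    | empty => simp
    | insert i t hi ih =>
      refine ih.trans ?_
      refine (measure_ball_le_of_eigenvector hμ (b.norm_eq_one i)
        (c := hsym.eigenvalues rfl i) (hsym.apply_eigenvectorBasis rfl i) _ r).trans_eq ?_
      have h0 : ⟪b i, ∑ j ∈ t, ⟪b j, v⟫ • b j⟫ = 0 := by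
        rw [inner_sum]
        refine Finset.sum_eq_zero fun j hj => ?_
        rw [inner_smul_right, b.inner_eq_zero (by rintro rfl; exact hi hj), mul_zero]
      rw [inner_sub_right, h0, sub_zero, Finset.sum_insert hi, sub_sub, add_comm]
  have h := key Finset.univ
  rwa [b.sum_repr' v, sub_self] at h

/-- Anderson's inequality for balls of a Hilbert space. -/
theorem measure_ball_le_measure_ball_zero (hμ : ∫ x, x ∂μ = 0) (v : E) (r : ℝ) :
    μ (Metric.ball v r) ≤ μ (Metric.ball 0 r) := by
  have hclosed : ∀ s : ℝ, μ (Metric.ball v s) ≤ μ (Metric.closedBall 0 s) := by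
    intro s
    set U : ℕ → Submodule ℝ E := fun n =>
      Submodule.span ℝ (TopologicalSpace.denseSeq E '' (Iic n)) with hU
    have hfin : ∀ n, FiniteDimensional ℝ (U n) := fun n =>
      FiniteDimensional.span_of_finite ℝ ((finite_Iic n).image _)
    have hmono : Monotone U := fun m n h =>
      Submodule.span_mono (image_mono (Iic_subset_Iic.2 h))
    have hdense : ⊤ ≤ (⨆ n, U n).topologicalClosure := by
      intro x _
      refine closure_mono ?_ (TopologicalSpace.denseRange_denseSeq E x)
      rintro _ ⟨n, rfl⟩
      exact (le_iSup U n) (Submodule.subset_span ⟨n, self_mem_Iic, rfl⟩)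
    -- Projecting to `U n` gives a centered Gaussian in finite dimension. The non-strict bound lets
    -- the sets on the right decrease to a subset of the closed ball.
    have hn : ∀ n, μ (Metric.ball v s) ≤ μ {x | ‖(U n).starProjection x‖ ≤ s} := by
      intro n
      have hmeas : Measurable (U n).orthogonalProjectionOnto :=
        (U n).orthogonalProjectionOnto.continuous.measurable
      have h0 : ∫ x, x ∂(μ.map (U n).orthogonalProjectionOnto) = 0 := by
        rw [integral_map hmeas.aemeasurable (by fun_prop)]
        rw [ContinuousLinearMap.integral_comp_comm _ IsGaussian.integrable_fun_id, hμ, map_zero]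
      have h1 := measure_ball_le_of_finiteDimensional h0 ((U n).orthogonalProjectionOnto v) s
      rw [Measure.map_apply hmeas Metric.isOpen_ball.measurableSet,
        Measure.map_apply hmeas Metric.isOpen_ball.measurableSet] at h1
      refine (measure_mono ?_).trans (h1.trans (measure_mono ?_))
      · intro x hx
        rw [mem_preimage, Metric.mem_ball, dist_eq_norm, ← map_sub]
        exact ((U n).norm_orthogonalProjectionOnto_apply_le _).trans_lt
          (by rwa [← dist_eq_norm])
      · intro x hx
        rw [mem_preimage, mem_ball_zero_iff] at hx
        exact hx.le
    have hanti : Antitone fun n => {x | ‖(U n).starProjection x‖ ≤ s} := by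
      intro m n hmn x hx
      refine le_trans ?_ (show ‖(U n).starProjection x‖ ≤ s from hx)
      have : (U m).starProjection x = (U m).starProjection ((U n).starProjection x) := by
        rw [Submodule.starProjection_apply, Submodule.starProjection_apply,
          Submodule.orthogonalProjectionOnto_starProjection_of_le (hmono hmn)]
      rw [this]
      exact (U m).norm_starProjection_apply_le _
    have hlim := tendsto_measure_iInter_atTop (μ := μ)
      (s := fun n => {x | ‖(U n).starProjection x‖ ≤ s})
      (fun n => (isClosed_le (by fun_prop) (by fun_prop)).measurableSet.nullMeasurableSet)
      hanti ⟨0, measure_ne_top _ _⟩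
    refine (ge_of_tendsto' hlim hn).trans (measure_mono fun x hx => ?_)
    rw [mem_iInter] at hx
    rw [mem_closedBall_zero_iff]
    exact le_of_tendsto' (Submodule.starProjection_tendsto_self U hmono x hdense).norm hx
  exact measure_ball_le_of_forall_lt fun s hs =>
    (hclosed s).trans (measure_mono (Metric.closedBall_subset_ball hs))

end Anderson

/-! ### Small balls compared with the ball at the origin. -/

theorem inner_covarianceOperator_self {E : Type*} [NormedAddCommGroup E] [InnerProductSpace ℝ E]
    [CompleteSpace E] [MeasurableSpace E] [BorelSpace E] {μ : Measure E} (w : E) :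
    ⟪covarianceOperator μ w, w⟫ = ‖covarianceSqrt μ w‖ ^ 2 := by
  rw [← covarianceSqrt_comp_self, ContinuousLinearMap.comp_apply,
    (covarianceSqrt_isPositive μ).inner_left_eq_inner_right, real_inner_self_eq_norm_sq]

section SmallBalls

variable {E : Type*} [NormedAddCommGroup E] [InnerProductSpace ℝ E] [CompleteSpace E]
  [SecondCountableTopology E] [MeasurableSpace E] [BorelSpace E]
  {μ : Measure E} [IsGaussian μ]

theorem ofReal_exp_mul_ofReal_exp_neg (a : ℝ) :
    ENNReal.ofReal (Real.exp a) * ENNReal.ofReal (Real.exp (-a)) = 1 := by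
  rw [← ENNReal.ofReal_mul (Real.exp_pos _).le, ← Real.exp_add]
  simp

/-- Shifting by `K w` has density at least `exp c` on `B_r(v)`, and Anderson bounds the mass of the
shifted ball. -/
theorem measure_ball_le_exp_mul (hμ : ∫ x, x ∂μ = 0) (v w : E) (r : ℝ) :
    μ (Metric.ball v r) ≤ ENNReal.ofReal
      (Real.exp (-(⟪w, v⟫ - ⟪covarianceOperator μ w, w⟫ / 2 - r * ‖w‖))) *
        μ (Metric.ball 0 r) := by
  set c := ⟪w, v⟫ - ⟪covarianceOperator μ w, w⟫ / 2 - r * ‖w‖ with hc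
  have hpre : (fun x => x + covarianceOperator μ w) ⁻¹' Metric.ball v r =
      Metric.ball (v - covarianceOperator μ w) r := by
    ext x
    simp only [mem_preimage, Metric.mem_ball, dist_eq_norm]
    rw [sub_sub_eq_add_sub]
  have h1 : ENNReal.ofReal (Real.exp c) * μ (Metric.ball v r) ≤ μ (Metric.ball 0 r) := by
    refine le_trans ?_ (measure_ball_le_measure_ball_zero hμ (v - covarianceOperator μ w) r)
    rw [← hpre, measure_preimage_add_covarianceOperator hμ w Metric.isOpen_ball.measurableSet,
      ← setLIntegral_const]
    refine setLIntegral_mono' Metric.isOpen_ball.measurableSet fun x hx => ?_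
    refine ENNReal.ofReal_le_ofReal (Real.exp_le_exp.2 ?_)
    have h2 : ⟪w, v - x⟫ ≤ r * ‖w‖ := by
      refine (real_inner_le_norm _ _).trans ?_
      rw [mul_comm]
      rw [Metric.mem_ball', dist_eq_norm] at hx
      gcongr
    rw [inner_sub_right] at h2
    rw [hc]
    linarith
  calc μ (Metric.ball v r)
      = ENNReal.ofReal (Real.exp (-c)) * (ENNReal.ofReal (Real.exp c) * μ (Metric.ball v r)) := by
        rw [← mul_assoc, mul_comm (ENNReal.ofReal (Real.exp (-c))),
          ofReal_exp_mul_ofReal_exp_neg, one_mul]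
    _ ≤ _ := by gcongr

theorem measure_ball_neg (hμ : ∫ x, x ∂μ = 0) (v : E) (r : ℝ) :
    μ (Metric.ball (-v) r) = μ (Metric.ball v r) := by
  nth_rw 2 [← map_neg_eq_self hμ]
  rw [Measure.map_apply (by fun_prop) Metric.isOpen_ball.measurableSet]
  congr 1
  ext x
  rw [mem_preimage, Metric.mem_ball, Metric.mem_ball, ← dist_neg_neg, neg_neg]

/-- Averaging the shifts by `K w` and `-K w`, whose balls have equal mass, turns the linear term
into `cosh ⟪w, x⟫ ≥ 1`. Hence there is no error term in `r`. -/
theorem measure_ball_zero_le_of_covarianceOperator (hμ : ∫ x, x ∂μ = 0) (w : E) (r : ℝ) :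
    μ (Metric.ball 0 r) ≤ ENNReal.ofReal (Real.exp (⟪covarianceOperator μ w, w⟫ / 2)) *
      μ (Metric.ball (covarianceOperator μ w) r) := by
  set c := ⟪covarianceOperator μ w, w⟫ / 2 with hc
  have hshift : ∀ z : E, μ (Metric.ball (-covarianceOperator μ z) r) =
      ∫⁻ x in Metric.ball 0 r,
        ENNReal.ofReal (Real.exp (⟪z, x⟫ - ⟪covarianceOperator μ z, z⟫ / 2)) ∂μ := by
    intro z
    rw [← measure_preimage_add_covarianceOperator hμ z Metric.isOpen_ball.measurableSet]
    congr 1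
    ext x
    simp [dist_eq_norm]
  have h1 := hshift w
  have h2 := hshift (-w)
  rw [measure_ball_neg hμ] at h1
  simp only [map_neg, neg_neg, inner_neg_left, inner_neg_right] at h2
  have h3 : 2 * (ENNReal.ofReal (Real.exp (-c)) * μ (Metric.ball 0 r)) ≤
      2 * μ (Metric.ball (covarianceOperator μ w) r) := by
    rw [two_mul (μ _)]
    nth_rw 1 [h1]
    rw [h2, ← lintegral_add_left (by fun_prop), ← mul_assoc, ← setLIntegral_const]
    refine lintegral_mono fun x => ?_
    rw [← ENNReal.ofReal_add (Real.exp_pos _).le (Real.exp_pos _).le,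
      ← ENNReal.ofReal_ofNat 2, ← ENNReal.ofReal_mul (by norm_num)]
    refine ENNReal.ofReal_le_ofReal ?_
    rw [← hc, sub_eq_add_neg, sub_eq_add_neg, Real.exp_add, Real.exp_add, ← add_mul]
    gcongr
    have h := Real.one_le_cosh ⟪w, x⟫
    rw [Real.cosh_eq] at h
    linarith
  have h4 := (ENNReal.mul_le_mul_iff_right (by norm_num) (by norm_num)).1 h3
  calc μ (Metric.ball 0 r)
      = ENNReal.ofReal (Real.exp c) * (ENNReal.ofReal (Real.exp (-c)) * μ (Metric.ball 0 r)) := by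
        rw [← mul_assoc, ofReal_exp_mul_ofReal_exp_neg, one_mul]
    _ ≤ _ := by gcongr

theorem measure_ball_zero_le_of_mem_closure (hμ : ∫ x, x ∂μ = 0) {x : E}
    (hx : x ∈ closure (range (covarianceSqrt μ))) (r : ℝ) :
    μ (Metric.ball 0 r) ≤ ENNReal.ofReal (Real.exp (‖x‖ ^ 2 / 2)) *
      μ (Metric.ball (covarianceSqrt μ x) r) := by
  refine measure_ball_le_of_forall_lt fun s hs => ?_
  obtain ⟨z, hz, hlim⟩ := mem_closure_iff_seq_limit.1 hx
  choose w hw using hz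
  have hcont : Continuous fun y : E => ENNReal.ofReal (Real.exp (‖y‖ ^ 2 / 2)) *
      μ (Metric.ball (covarianceSqrt μ x) r) :=
    ENNReal.continuous_mul_const (measure_ne_top _ _) |>.comp
      (ENNReal.continuous_ofReal.comp (by fun_prop))
  refine ge_of_tendsto ((hcont.tendsto x).comp hlim) ?_
  have hball := ((covarianceSqrt μ).continuous.tendsto x).comp hlim
  filter_upwards [hball (Metric.ball_mem_nhds _ (sub_pos.2 hs))] with n hn
  refine (measure_ball_zero_le_of_covarianceOperator hμ (w n) s).trans ?_
  rw [inner_covarianceOperator_self, hw, Function.comp_apply]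
  gcongr
  refine Metric.ball_subset_ball' ?_
  rw [← covarianceSqrt_comp_self, ContinuousLinearMap.comp_apply, hw]
  have : dist (covarianceSqrt μ (z n)) (covarianceSqrt μ x) < r - s := hn
  linarith

/-- The component of `x` orthogonal to the range closure is killed by the self-adjoint root, so
projecting keeps the image and does not increase the norm. -/
theorem measure_ball_zero_le_exp_mul (hμ : ∫ x, x ∂μ = 0) (x : E) (r : ℝ) :
    μ (Metric.ball 0 r) ≤ ENNReal.ofReal (Real.exp (‖x‖ ^ 2 / 2)) *
      μ (Metric.ball (covarianceSqrt μ x) r) := by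
  set V := (LinearMap.range (covarianceSqrt μ).toLinearMap).topologicalClosure
  have : CompleteSpace V := Submodule.isClosed_topologicalClosure _ |>.completeSpace_coe
  set p := V.starProjection x
  have hp : p ∈ closure (range (covarianceSqrt μ)) := by
    have h : p ∈ closure (LinearMap.range (covarianceSqrt μ).toLinearMap : Set E) :=
      V.starProjection_apply_mem x
    rwa [LinearMap.coe_range] at h
  have hS : covarianceSqrt μ x = covarianceSqrt μ p := by
    rw [← sub_eq_zero, ← map_sub, ← inner_self_eq_zero (𝕜 := ℝ),
      (covarianceSqrt_isPositive μ).inner_left_eq_inner_right, real_inner_comm]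
    exact Submodule.sub_starProjection_mem_orthogonal (K := V) x _
      (Submodule.le_topologicalClosure _ ⟨_, rfl⟩)
  rw [hS]
  refine (measure_ball_zero_le_of_mem_closure hμ hp r).trans ?_
  gcongr
  exact V.norm_starProjection_apply_le x

theorem measure_ball_zero_pos (hμ : ∫ x, x ∂μ = 0) {r : ℝ} (hr : 0 < r) :
    0 < μ (Metric.ball 0 r) := by
  obtain ⟨v, hv⟩ := Measure.nonempty_support (IsProbabilityMeasure.ne_zero μ)
  exact ((Measure.mem_support_iff_forall v).1 hv _ (Metric.ball_mem_nhds v hr)).trans_le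
    (measure_ball_le_measure_ball_zero hμ v r)

end SmallBalls

/-! ### Duality for minimal-norm preimages. -/

/-- Scaling `l` makes the hypothesis the bound `|⟪l, z⟫| ≤ a ‖T* l‖`. Thus `T* l ↦ ⟪l, z⟫` is a
bounded functional on the range of `T*`; Hahn–Banach and Riesz represent it by the desired `x`. -/
theorem exists_apply_eq_norm_le_of_forall_inner_le {X Y : Type*} [NormedAddCommGroup X]
    [InnerProductSpace ℝ X] [CompleteSpace X] [NormedAddCommGroup Y] [InnerProductSpace ℝ Y]
    [CompleteSpace Y] (T : X →L[ℝ] Y) {z : Y} {a : ℝ} (ha : 0 ≤ a)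
    (h : ∀ l : Y, ⟪l, z⟫ - ‖T.adjoint l‖ ^ 2 / 2 ≤ a ^ 2 / 2) : ∃ x, T x = z ∧ ‖x‖ ≤ a := by
  have hb : ∀ l : Y, |⟪l, z⟫| ≤ a * ‖T.adjoint l‖ := by
    intro l
    have hd : discrim (‖T.adjoint l‖ ^ 2 / 2) (-⟪l, z⟫) (a ^ 2 / 2) ≤ 0 := by
      refine discrim_le_zero fun t => ?_
      have := h (t • l)
      rw [map_smul, norm_smul, inner_smul_left, mul_pow, Real.norm_eq_abs, sq_abs,
        RCLike.conj_to_real] at this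
      linarith
    rw [discrim] at hd
    refine abs_le_of_sq_le_sq ?_ (by positivity)
    linarith
  obtain ⟨g, hg⟩ := LinearMap.exists_rightInverse_of_surjective
    T.adjoint.toLinearMap.rangeRestrict (LinearMap.range_rangeRestrict _)
  have hg' : ∀ p, T.adjoint (g p) = p := fun p => congrArg Subtype.val (LinearMap.congr_fun hg p)
  set f : StrongDual ℝ (LinearMap.range T.adjoint.toLinearMap) :=
    LinearMap.mkContinuous ((innerSL ℝ z).toLinearMap ∘ₗ g) a fun p => by
      have := hb (g p)
      rw [hg', real_inner_comm] at this
      simpa using this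
  have hf : ∀ p, f p = ⟪z, g p⟫ := fun p => by simp [f]
  obtain ⟨F, hF, hFn⟩ := exists_extension_norm_eq _ f
  refine ⟨(InnerProductSpace.toDual ℝ X).symm F, ?_, ?_⟩
  · refine ext_inner_right ℝ fun l => ?_
    rw [← ContinuousLinearMap.adjoint_inner_right, InnerProductSpace.toDual_symm_apply]
    have h1 := hF ⟨T.adjoint l, l, rfl⟩
    -- The choice of preimage `g` is immaterial: elements of the kernel of `T*` are orthogonal to
    -- `z`.
    have h2 := hb (g ⟨T.adjoint l, l, rfl⟩ - l)
    rw [map_sub, hg', sub_self, norm_zero, mul_zero, abs_nonpos_iff, inner_sub_left,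
      sub_eq_zero] at h2
    rw [hf, real_inner_comm, h2, real_inner_comm] at h1
    exact h1
  · rw [LinearIsometryEquiv.norm_map, hFn]
    exact LinearMap.mkContinuous_norm_le _ ha _

/-! ### Conditional modes and constrained minimizers. -/

section ConditionalModes

variable {X : Type*} [NormedAddCommGroup X] [InnerProductSpace ℝ X] [CompleteSpace X]
  [MeasurableSpace X] [BorelSpace X]

theorem cameronMartinNorm_le {μ : Measure X} {x u : X} (h : covarianceSqrt μ x = u) :
    cameronMartinNorm μ u ≤ ‖x‖ₑ :=
  iInf₂_le x h

theorem LipschitzOnBalls.continuous {E E' : Type*} [NormedAddCommGroup E] [NormedAddCommGroup E']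
    {F : E → E'} (hF : LipschitzOnBalls F) : Continuous F := by
  refine continuous_iff_continuousAt.2 fun z => ?_
  obtain ⟨C, hC, h⟩ := hF (‖z‖ + 1) (by positivity)
  have hL : LipschitzOnWith C.toNNReal F (Metric.ball 0 (‖z‖ + 1)) := by
    refine LipschitzOnWith.of_dist_le_mul fun x hx w hw => ?_
    rw [dist_eq_norm, dist_eq_norm, Real.coe_toNNReal _ hC.le]
    exact h x hx w hw
  exact hL.continuousOn.continuousAt (Metric.isOpen_ball.mem_nhds (by simp))

theorem exists_continuousLinearMap_eq_observation {X : Type*} [NormedAddCommGroup X]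
    [InnerProductSpace ℝ X] {N : ℕ} (φ : Fin N → StrongDual ℝ X) :
    ∃ Φ : X →L[ℝ] EuclideanSpace ℝ (Fin N), ⇑Φ = observation φ :=
  ⟨(EuclideanSpace.equiv (Fin N) ℝ).symm.toContinuousLinearMap ∘L ContinuousLinearMap.pi φ, rfl⟩

variable [SecondCountableTopology X] {μ : Measure X} [IsGaussian μ]

/-- Uniform small-ball estimate over the preimage of a closed set under a finite-rank map. -/
theorem eventually_measure_ball_le (hμ : ∫ x, x ∂μ = 0) {Y : Type*} [NormedAddCommGroup Y]
    [InnerProductSpace ℝ Y] [FiniteDimensional ℝ Y] [CompleteSpace Y] (Φ : X →L[ℝ] Y) {C : Set Y}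
    (hC : IsClosed C) {a : ℝ} (ha : 0 ≤ a)
    (hmin : ∀ v, Φ v ∈ C → ENNReal.ofReal a ≤ cameronMartinNorm μ v) {ε : ℝ} (hε : 0 < ε) :
    ∀ᶠ r in 𝓝[>] (0 : ℝ), ∀ v, Φ v ∈ C → μ (Metric.ball v r) ≤
      ENNReal.ofReal (Real.exp (-(a ^ 2 / 2 - ε))) * μ (Metric.ball 0 r) := by
  set T := Φ ∘L covarianceSqrt μ with hT
  have hTadj : ∀ l, ‖T.adjoint l‖ ^ 2 = ⟪covarianceOperator μ (Φ.adjoint l), Φ.adjoint l⟫ := by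
    intro l
    rw [inner_covarianceOperator_self, hT, ContinuousLinearMap.adjoint_comp,
      ContinuousLinearMap.comp_apply, (covarianceSqrt_isPositive μ).isSelfAdjoint.adjoint_eq]
  have hball : ∀ l v r, ∀ s ≤ ⟪l, Φ v⟫ - ‖T.adjoint l‖ ^ 2 / 2 - r * ‖Φ.adjoint l‖,
      μ (Metric.ball v r) ≤ ENNReal.ofReal (Real.exp (-s)) * μ (Metric.ball 0 r) := by
    intro l v r s hs
    refine (measure_ball_le_exp_mul hμ v (Φ.adjoint l) r).trans ?_
    rw [hTadj, ← ContinuousLinearMap.adjoint_inner_left] at hs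
    gcongr
  -- Otherwise duality yields a preimage of `z` under `T` of norm at most `√(a² - ε) < a`, against
  -- `hmin`; taking `l = 0` shows that the radicand is nonnegative.
  have hdual : ∀ z ∈ C, ∃ l, a ^ 2 / 2 - ε / 2 < ⟪l, z⟫ - ‖T.adjoint l‖ ^ 2 / 2 := by
    intro z hz
    by_contra! hcon
    have h0 : 0 ≤ a ^ 2 - ε := by
      have := hcon 0
      simp at this
      linarith
    obtain ⟨x, hx, hxn⟩ := exists_apply_eq_norm_le_of_forall_inner_le T
      (Real.sqrt_nonneg (a ^ 2 - ε)) (z := z) fun l => by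
        rw [Real.sq_sqrt h0]
        linarith [hcon l]
    have h1 := (hmin (covarianceSqrt μ x) (by rw [← hx] at hz; exact hz)).trans
      (cameronMartinNorm_le rfl)
    rw [← ofReal_norm, ENNReal.ofReal_le_ofReal_iff (norm_nonneg x)] at h1
    have h3 : √(a ^ 2 - ε) ^ 2 = a ^ 2 - ε := Real.sq_sqrt h0
    nlinarith [h1.trans hxn]
  choose! l hl using hdual
  set b := stdOrthonormalBasis ℝ Y
  -- Chosen so that, once a coordinate of `Φ v` exceeds `R` in absolute value, the single dual
  -- vector `±b i` gives exponent at least `a²/2` for all `r ≤ 1`. Only the compact part `D` then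
  -- needs covering.
  set R := a ^ 2 / 2 + ∑ i, (‖T.adjoint (b i)‖ ^ 2 / 2 + ‖Φ.adjoint (b i)‖) with hR
  have hRi : ∀ i, a ^ 2 / 2 + (‖T.adjoint (b i)‖ ^ 2 / 2 + ‖Φ.adjoint (b i)‖) ≤ R := by
    intro i
    rw [hR]
    gcongr
    exact Finset.single_le_sum
      (f := fun i => ‖T.adjoint (b i)‖ ^ 2 / 2 + ‖Φ.adjoint (b i)‖)
      (fun j _ => by positivity) (Finset.mem_univ i)
  set D := C ∩ ⋂ i, {z | |⟪b i, z⟫| ≤ R} with hD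
  have hDc : IsCompact D := by
    refine Metric.isCompact_of_isClosed_isBounded ?_ ?_
    · exact hC.inter (isClosed_iInter fun i => isClosed_le (by fun_prop) (by fun_prop))
    · refine isBounded_iff_forall_norm_le.2 ⟨∑ _i : Fin (Module.finrank ℝ Y), R, fun z hz => ?_⟩
      rw [← b.sum_repr' z]
      refine (norm_sum_le _ _).trans (Finset.sum_le_sum fun i _ => ?_)
      rw [norm_smul, b.norm_eq_one, mul_one]
      exact mem_iInter.1 hz.2 i
  obtain ⟨t, htC, htf, ht⟩ := hDc.elim_finite_subcover_image (b := C)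
    (c := fun z' => {z | a ^ 2 / 2 - ε / 2 < ⟪l z', z⟫ - ‖T.adjoint (l z')‖ ^ 2 / 2})
    (fun z' _ => isOpen_lt (by fun_prop) (by fun_prop))
    (fun z hz => mem_biUnion hz.1 (by exact hl z hz.1))
  have hsmall : ∀ᶠ r in 𝓝[>] (0 : ℝ), ∀ z ∈ t, r * ‖Φ.adjoint (l z)‖ < ε / 2 := by
    refine (htf.eventually_all).2 fun z _ => ?_
    have hlim : Tendsto (fun r : ℝ => r * ‖Φ.adjoint (l z)‖) (𝓝[>] 0) (𝓝 0) :=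
      Tendsto.mono_left (by simpa using (continuous_mul_const ‖Φ.adjoint (l z)‖).tendsto (0 : ℝ))
        nhdsWithin_le_nhds
    exact hlim.eventually_lt_const (half_pos hε)
  filter_upwards [hsmall, Ioc_mem_nhdsGT (zero_lt_one' ℝ)] with r hr hr1 v hv
  by_cases hvD : ∀ i, |⟪b i, Φ v⟫| ≤ R
  · obtain ⟨z, hzt, hz⟩ := mem_iUnion₂.1 (ht ⟨hv, mem_iInter.2 hvD⟩)
    have hz' : a ^ 2 / 2 - ε / 2 < ⟪l z, Φ v⟫ - ‖T.adjoint (l z)‖ ^ 2 / 2 := hz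
    exact hball (l z) v r _ (by linarith [hr z hzt])
  · push Not at hvD
    obtain ⟨i, hi⟩ := hvD
    have h1 : r * ‖Φ.adjoint (b i)‖ ≤ ‖Φ.adjoint (b i)‖ :=
      mul_le_of_le_one_left (norm_nonneg _) hr1.2
    rcases lt_abs.1 hi with h | h
    · exact hball (b i) v r _ (by linarith [hRi i])
    · refine hball (-b i) v r _ ?_
      rw [map_neg, map_neg, norm_neg, norm_neg, inner_neg_left]
      linarith [hRi i]

/-- For a preimage `x` of a competitor, the two ball bounds control the mode ratio; its limit `1`
forces every dual value of `u` below `‖x‖²/2`, and duality gives a preimage of `u` no longer than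
`x`. -/
theorem IsConditionalMode.isConstrainedMinimizer (hμ : ∫ x, x ∂μ = 0) {Y : Type*}
    [TopologicalSpace Y] [MeasurableSpace Y] {T : X → Y} {y : Y} {u : X}
    (h : IsConditionalMode μ T y u) : IsConstrainedMinimizer μ T y u := by
  obtain ⟨-, hu, hlim⟩ := h
  refine ⟨hu, fun v hv => le_iInf₂ fun x hx => ?_⟩
  have key : ∀ w, ⟪w, u⟫ - ‖(covarianceSqrt μ).adjoint w‖ ^ 2 / 2 ≤ ‖x‖ ^ 2 / 2 := by
    intro w
    rw [(covarianceSqrt_isPositive μ).isSelfAdjoint.adjoint_eq, ← inner_covarianceOperator_self]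
    set c := ⟪w, u⟫ - ⟪covarianceOperator μ w, w⟫ / 2 with hc
    have hle : ∀ r, μ (Metric.ball u r) / (⨆ v ∈ T ⁻¹' {y}, μ (Metric.ball v r)) ≤
        ENNReal.ofReal (Real.exp (-(c - r * ‖w‖) + ‖x‖ ^ 2 / 2)) := by
      intro r
      refine ENNReal.div_le_of_le_mul ((measure_ball_le_exp_mul hμ u w r).trans ?_)
      rw [Real.exp_add, ENNReal.ofReal_mul (Real.exp_pos _).le, mul_assoc]
      gcongr
      refine (measure_ball_zero_le_exp_mul hμ x r).trans ?_
      rw [hx]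
      gcongr
      exact le_iSup₂ (f := fun v (_ : v ∈ T ⁻¹' {y}) => μ (Metric.ball v r)) v hv
    have hcont : Continuous fun r : ℝ =>
        ENNReal.ofReal (Real.exp (-(c - r * ‖w‖) + ‖x‖ ^ 2 / 2)) :=
      ENNReal.continuous_ofReal.comp (by fun_prop)
    have h1 := le_of_tendsto_of_tendsto' hlim
      ((hcont.tendsto 0).mono_left nhdsWithin_le_nhds) hle
    rw [ENNReal.one_le_ofReal, Real.one_le_exp_iff] at h1
    linarith
  obtain ⟨x', hx', hn⟩ :=
    exists_apply_eq_norm_le_of_forall_inner_le (covarianceSqrt μ) (norm_nonneg x) key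
  exact (cameronMartinNorm_le hx').trans (by rw [← ofReal_norm, ← ofReal_norm]; exact ENNReal.ofReal_le_ofReal hn)

theorem measure_ball_zero_le_of_cameronMartinNorm (hμ : ∫ x, x ∂μ = 0) {u : X}
    (hu : cameronMartinNorm μ u ≠ ∞) (r : ℝ) :
    μ (Metric.ball 0 r) ≤ ENNReal.ofReal (Real.exp ((cameronMartinNorm μ u).toReal ^ 2 / 2)) *
      μ (Metric.ball u r) := by
  have hcont : Continuous fun b : ℝ =>
      ENNReal.ofReal (Real.exp (b ^ 2 / 2)) * μ (Metric.ball u r) :=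
    ENNReal.continuous_mul_const (measure_ne_top _ _) |>.comp
      (ENNReal.continuous_ofReal.comp (by fun_prop))
  -- Letting `b` decrease to the norm avoids asking that the infimum be attained.
  refine ge_of_tendsto ((hcont.tendsto (cameronMartinNorm μ u).toReal).mono_left
    (nhdsWithin_le_nhds (s := Ioi (cameronMartinNorm μ u).toReal))) ?_
  filter_upwards [self_mem_nhdsWithin] with b hb
  have hb' : cameronMartinNorm μ u < ENNReal.ofReal b :=
    (ENNReal.lt_ofReal_iff_toReal_lt hu).2 hb
  simp only [cameronMartinNorm, iInf_lt_iff] at hb'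
  obtain ⟨x, hx, hxb⟩ := hb'
  have hb0 : 0 < b := ENNReal.toReal_nonneg.trans_lt hb
  rw [← ofReal_norm, ENNReal.ofReal_lt_ofReal_iff hb0] at hxb
  refine (measure_ball_zero_le_exp_mul hμ x r).trans ?_
  rw [hx]
  gcongr

/-- The lower bound at `u` and the uniform upper bound over the fibre carry the same `a²/2`, so the
ratio is eventually at least `exp(-ε)`; it never exceeds `1`. -/
theorem IsConstrainedMinimizer.isConditionalMode (hμ : ∫ x, x ∂μ = 0) {Y Z : Type*}
    [NormedAddCommGroup Y] [InnerProductSpace ℝ Y] [FiniteDimensional ℝ Y] [CompleteSpace Y]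
    [TopologicalSpace Z] [T1Space Z] [MeasurableSpace Z] [BorelSpace Z] {Φ : X →L[ℝ] Y} {F : Y → Z}
    (hF : Continuous F) {y : Z} {u : X} (hu : cameronMartinNorm μ u ≠ ∞)
    (h : IsConstrainedMinimizer μ (fun v => F (Φ v)) y u) :
    IsConditionalMode μ (fun v => F (Φ v)) y u := by
  obtain ⟨huy, hmin⟩ := h
  set a := (cameronMartinNorm μ u).toReal with ha
  have hcont : Continuous fun v => F (Φ v) := hF.comp Φ.continuous
  have hpos : ∀ r > 0, 0 < μ (Metric.ball u r) := by
    intro r hr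
    by_contra! h0
    have h1 := measure_ball_zero_le_of_cameronMartinNorm hμ hu r
    rw [nonpos_iff_eq_zero.1 h0, mul_zero] at h1
    exact (measure_ball_zero_pos hμ hr).not_ge h1
  refine ⟨(Measure.mem_support_iff_forall y).2 fun U hU => ?_, huy, ?_⟩
  · refine lt_of_lt_of_le ?_ (Measure.le_map_apply hcont.measurable.aemeasurable U)
    have hU' : (fun v => F (Φ v)) ⁻¹' U ∈ 𝓝 u := hcont.continuousAt.preimage_mem_nhds (by rwa [← huy] at hU)
    obtain ⟨r, hr, hrU⟩ := Metric.mem_nhds_iff.1 hU'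
    exact (hpos r hr).trans_le (measure_mono hrU)
  · set s : ℝ → ℝ≥0∞ := fun r => ⨆ v ∈ (fun v => F (Φ v)) ⁻¹' {y}, μ (Metric.ball v r) with hs
    have hle : ∀ r, μ (Metric.ball u r) ≤ s r := fun r =>
      le_iSup₂ (f := fun v (_ : v ∈ (fun v => F (Φ v)) ⁻¹' {y}) => μ (Metric.ball v r)) u huy
    have hs1 : ∀ r, s r ≠ ∞ := fun r =>
      ((iSup₂_le fun _ _ => prob_le_one : s r ≤ 1).trans_lt ENNReal.one_lt_top).ne
    refine tendsto_order.2 ⟨fun c hc => ?_, fun c hc => ?_⟩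
    · have hexp : Tendsto (fun ε : ℝ => ENNReal.ofReal (Real.exp (-ε))) (𝓝[>] 0) (𝓝 1) := by
        have : Continuous fun ε : ℝ => ENNReal.ofReal (Real.exp (-ε)) :=
          ENNReal.continuous_ofReal.comp (by fun_prop)
        simpa using (this.tendsto 0).mono_left (nhdsWithin_le_nhds (s := Ioi (0 : ℝ)))
      obtain ⟨ε, hcε, hε⟩ := ((hexp.eventually_const_lt hc).and self_mem_nhdsWithin).exists
      have hev := eventually_measure_ball_le hμ Φ (isClosed_singleton.preimage hF)
        (C := F ⁻¹' {y}) (a := a) ENNReal.toReal_nonneg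
        (fun v hv => by rw [ha, ENNReal.ofReal_toReal hu]; exact hmin v hv) hε
      filter_upwards [hev, self_mem_nhdsWithin] with r hr hr0
      refine hcε.trans_le ?_
      have hsr : s r ≤ ENNReal.ofReal (Real.exp ε) * μ (Metric.ball u r) := by
        refine iSup₂_le fun v hv => (hr v hv).trans ?_
        have h1 : ENNReal.ofReal (Real.exp ε) = ENNReal.ofReal (Real.exp (-(a ^ 2 / 2 - ε))) *
            ENNReal.ofReal (Real.exp (a ^ 2 / 2)) := by
          rw [← ENNReal.ofReal_mul (Real.exp_pos _).le, ← Real.exp_add]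
          congr 2
          ring
        rw [h1, mul_assoc]
        gcongr
        exact measure_ball_zero_le_of_cameronMartinNorm hμ hu r
      rw [ENNReal.le_div_iff_mul_le (Or.inl ((hpos r hr0).trans_le (hle r)).ne')
        (Or.inl (hs1 r))]
      calc ENNReal.ofReal (Real.exp (-ε)) * s r
          ≤ ENNReal.ofReal (Real.exp (-ε)) *
              (ENNReal.ofReal (Real.exp ε) * μ (Metric.ball u r)) := by gcongr
        _ = μ (Metric.ball u r) := by
          rw [← mul_assoc, mul_comm (ENNReal.ofReal (Real.exp (-ε))),
            ofReal_exp_mul_ofReal_exp_neg, one_mul]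
    · exact Eventually.of_forall fun r => (ENNReal.div_le_of_le_mul (by rw [one_mul]; exact hle r)).trans_lt hc

end ConditionalModes

theorem mainTheorem8 {X : Type*} [NormedAddCommGroup X] [InnerProductSpace ℝ X] [CompleteSpace X]
    [SecondCountableTopology X] [MeasurableSpace X] [BorelSpace X]
    (μ : Measure X) [IsGaussian μ] (hμ : ∫ x, x ∂μ = 0)
    {N M : ℕ} (φ : Fin N → StrongDual ℝ X)
    (F : EuclideanSpace ℝ (Fin N) → EuclideanSpace ℝ (Fin M)) (hF : LipschitzOnBalls F)
    (y : EuclideanSpace ℝ (Fin M))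
    (hy : y ∈ (fun u => F (observation φ u)) '' (cameronMartinSpace μ : Set X))
    (u : X) :
    IsConditionalMode μ (fun v => F (observation φ v)) y u ↔
      IsConstrainedMinimizer μ (fun v => F (observation φ v)) y u := by
  refine ⟨fun h => h.isConstrainedMinimizer hμ, fun h => ?_⟩
  obtain ⟨_, ⟨x, rfl⟩, hxy⟩ := hy
  -- Feasibility within the Cameron–Martin space makes the minimum finite.
  have hu : cameronMartinNorm μ u ≠ ∞ :=
    (((h.2 _ hxy).trans (cameronMartinNorm_le rfl)).trans_lt enorm_lt_top).ne
  obtain ⟨Φ, hΦ⟩ := exists_continuousLinearMap_eq_observation φ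
  rw [← hΦ] at h ⊢
  exact h.isConditionalMode hμ hF.continuous hu
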